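/- Let $A$ and $B$ be quantum systems with nonzero finite-dimensional Hilbert spaces of dimensions $d_A,d_B\ge 1$, and let $\mathcal E=\mathcal E_{A\to B}$ be an arbitrary Hermitian-preserving linear map, i.e. a complex-linear map from operators on $A$ to operators on $B$ that maps Hermitian operators to Hermitian operators. A quantum instrument is a finite family $\{\mathcal M_j\}$ of completely positive trace-non-increasing maps whose sum is completely positive and trace-preserving. A twisted channel is a linear map of the form $\mathcal T=\sum_j s_j\mathcal M_j$ with $s_j\in\{+1,-1\}$ and $\{\mathcal M_j\}$ a quantum instrument; $\mathrm{TC}$ denotes the set of twisted channels from $A$ to $B$. The simulation cost of $\mathcal E$ with twisted channels is $$\gamma_{\rm TC}(\mathcal E)=\min\{\alpha\in\mathbb R \mid \mathcal E=\alpha\mathcal T,\ \alpha\ge 0,\ \mathcal T\in \mathrm{TC}\}.$$ Let $J^{\mathcal E}=(\mathrm{id}_A\otimes\mathcal E_{A'\to B})(|\Gamma\rangle\langle\Gamma|)$, with $|\Gamma\rangle=\sum_{j=1}^{d_A}|j\rangle_A|j\rangle_{A'}$ and $A'$ a copy of $A$, be the Choi operator of $\mathcal E$, and let $$\|\mathcal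 E\|_\diamond=\max_{\rho_{A'A}}\big\|(\mathrm{id}_{A'}\otimes\mathcal E)(\rho_{A'A})\big\|_1$$ be its diamond norm, where $\rho_{A'A}$ ranges over all states (positive semidefinite operators of trace one) on $A'\otimes A$, $\dim A'=\dim A$, and $\|\cdot\|_1$ is the trace norm. Then all of these optima, and the one below, are attained, $$\gamma_{\rm TC}(\mathcal E)=\min\{\alpha\in\mathbb R \mid J^{\mathcal E}=M^+-M^-,\ M^\pm\ge 0,\ \mathrm{tr}_B[M^++M^-]=\alpha\mathbb 1_A\},$$ where $M^\pm$ range over operators on $A\otimes B$, and $$\gamma_{\rm TC}(\mathcal E)=\|\mathcal E\|_\diamond .$$ -/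

import Mathlib

open scoped ComplexOrder Kronecker

noncomputable section

namespace QuantumMap

/- Finite-dimensional systems `A`, `B` are the Hilbert spaces with orthonormal bases indexed by
finite types `a`, `b`; their operators are square complex matrices. A composite system has the
product index type. -/

/-- A linear map `E` from operators on `A` to operators on `B` is Hermitian-preserving. -/
def IsHermitianPreserving {a b : Type*} (E : Matrix a a ℂ →ₗ[ℂ] Matrix b b ℂ) : Prop :=
  ∀ X : Matrix a a ℂ, X.IsHermitian → (E X).IsHermitian

/-- The map `id ⊗ E`, taking operators on `K ⊗ A` to operators on `K ⊗ B`: it applies `E` to each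
of the blocks, indexed by pairs of basis vectors of `K`, of its argument. -/
def idTensor (k : Type*) {a b : Type*} (E : Matrix a a ℂ →ₗ[ℂ] Matrix b b ℂ) :
    Matrix (k × a) (k × a) ℂ →ₗ[ℂ] Matrix (k × b) (k × b) ℂ where
  toFun X := Matrix.of fun p q => E (Matrix.of fun x y => X (p.1, x) (q.1, y)) p.2 q.2
  map_add' X Y := by
    ext p q
    exact congrFun (congrFun (E.map_add (Matrix.of fun x y => X (p.1, x) (q.1, y))
      (Matrix.of fun x y => Y (p.1, x) (q.1, y))) p.2) q.2
  map_smul' c X := by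
    ext p q
    exact congrFun (congrFun (E.map_smul c (Matrix.of fun x y => X (p.1, x) (q.1, y))) p.2) q.2

/-- `id ⊗ E` sends the product operator `R ⊗ X` to `R ⊗ E X`. -/
theorem idTensor_kronecker {k a b : Type*} (E : Matrix a a ℂ →ₗ[ℂ] Matrix b b ℂ)
    (R : Matrix k k ℂ) (X : Matrix a a ℂ) : idTensor k E (R ⊗ₖ X) = R ⊗ₖ E X := by
  ext p q
  exact congrFun (congrFun (E.map_smul (R p.1 q.1) X) p.2) q.2

/-- `E` is completely positive: `id ⊗ E` preserves positive semidefiniteness for every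
finite-dimensional ancilla. -/
def IsCompletelyPositive {a b : Type*} (E : Matrix a a ℂ →ₗ[ℂ] Matrix b b ℂ) : Prop :=
  ∀ (k : ℕ) (X : Matrix (Fin k × a) (Fin k × a) ℂ),
    X.PosSemidef → (idTensor (Fin k) E X).PosSemidef

/-- `E` is trace-non-increasing: the trace of a positive semidefinite operator does not grow. -/
def IsTraceNonincreasing {a b : Type*} [Fintype a] [Fintype b]
    (E : Matrix a a ℂ →ₗ[ℂ] Matrix b b ℂ) : Prop :=
  ∀ X : Matrix a a ℂ, X.PosSemidef → (E X).trace.re ≤ X.trace.re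

/-- `E` is trace-preserving. -/
def IsTracePreserving {a b : Type*} [Fintype a] [Fintype b]
    (E : Matrix a a ℂ →ₗ[ℂ] Matrix b b ℂ) : Prop :=
  ∀ X : Matrix a a ℂ, (E X).trace = X.trace

/-- Completely positive and trace-non-increasing maps. -/
def IsCPTN {a b : Type*} [Fintype a] [Fintype b]
    (E : Matrix a a ℂ →ₗ[ℂ] Matrix b b ℂ) : Prop :=
  IsCompletelyPositive E ∧ IsTraceNonincreasing E

/-- Completely positive and trace-preserving maps. -/
def IsCPTP {a b : Type*} [Fintype a] [Fintype b]
    (E : Matrix a a ℂ →ₗ[ℂ] Matrix b b ℂ) : Prop :=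
  IsCompletelyPositive E ∧ IsTracePreserving E

/-- A quantum instrument: a finite family of CPTN maps whose sum is CPTP. -/
def IsQuantumInstrument {a b : Type*} [Fintype a] [Fintype b] {n : ℕ}
    (M : Fin n → (Matrix a a ℂ →ₗ[ℂ] Matrix b b ℂ)) : Prop :=
  (∀ j, IsCPTN (M j)) ∧ IsCPTP (∑ j, M j)

/-- A twisted channel: a map `∑ j, s j • M j` with signs `s j` and a quantum instrument `M`. -/
def IsTwistedChannel {a b : Type*} [Fintype a] [Fintype b]
    (T : Matrix a a ℂ →ₗ[ℂ] Matrix b b ℂ) : Prop :=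
  ∃ (n : ℕ) (s : Fin n → ℂ) (M : Fin n → (Matrix a a ℂ →ₗ[ℂ] Matrix b b ℂ)),
    (∀ j, s j = 1 ∨ s j = -1) ∧ IsQuantumInstrument M ∧ T = ∑ j, s j • M j

/-- The numbers `α ≥ 0` such that `E = α T` for a twisted channel `T`. -/
def twistedCosts {a b : Type*} [Fintype a] [Fintype b]
    (E : Matrix a a ℂ →ₗ[ℂ] Matrix b b ℂ) : Set ℝ :=
  {α | 0 ≤ α ∧ ∃ T : Matrix a a ℂ →ₗ[ℂ] Matrix b b ℂ, IsTwistedChannel T ∧ E = (α : ℂ) • T}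

/-- The simulation cost of `E` with twisted channels. -/
def simulationCost {a b : Type*} [Fintype a] [Fintype b]
    (E : Matrix a a ℂ →ₗ[ℂ] Matrix b b ℂ) : ℝ :=
  sInf (twistedCosts E)

/-- The unnormalized maximally entangled vector `∑ j, |j⟩|j⟩`. -/
def maxEntangled (a : Type*) [DecidableEq a] : a × a → ℂ :=
  fun p => if p.1 = p.2 then 1 else 0

/-- The Choi operator `(id ⊗ E)(|Γ⟩⟨Γ|)` of `E`, an operator on `A ⊗ B`. -/
def choi {a b : Type*} [DecidableEq a] (E : Matrix a a ℂ →ₗ[ℂ] Matrix b b ℂ) :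
    Matrix (a × b) (a × b) ℂ :=
  idTensor a E (Matrix.vecMulVec (maxEntangled a) (star (maxEntangled a)))

/-- The partial trace over the second system. -/
def partialTraceRight {a b : Type*} [Fintype b] (M : Matrix (a × b) (a × b) ℂ) : Matrix a a ℂ :=
  Matrix.of fun i j => ∑ x, M (i, x) (j, x)

/-- The values `α` that are feasible for the semidefinite program
`J = M⁺ - M⁻`, `M⁺ ≥ 0`, `M⁻ ≥ 0`, `tr_B (M⁺ + M⁻) = α 1`, with `J` the Choi operator of `E`. -/
def sdpValues {a b : Type*} [Fintype b] [DecidableEq a]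
    (E : Matrix a a ℂ →ₗ[ℂ] Matrix b b ℂ) : Set ℝ :=
  {α | ∃ Mp Mm : Matrix (a × b) (a × b) ℂ, choi E = Mp - Mm ∧ Mp.PosSemidef ∧ Mm.PosSemidef ∧
    partialTraceRight (Mp + Mm) = (α : ℂ) • (1 : Matrix a a ℂ)}

/-- The trace norm: the sum of the singular values, which are the square roots of the eigenvalues
of `Xᴴ X`. -/
def traceNorm {c : Type*} [Fintype c] [DecidableEq c] (X : Matrix c c ℂ) : ℝ :=
  ∑ i, √((Matrix.isHermitian_conjTranspose_mul_self X).eigenvalues i)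

/-- Density operators: positive semidefinite of trace one. -/
def IsState {c : Type*} [Fintype c] (ρ : Matrix c c ℂ) : Prop :=
  ρ.PosSemidef ∧ ρ.trace = 1

/-- The numbers `‖(id ⊗ E) ρ‖₁`, with `ρ` a state of `A' ⊗ A` and `A'` a copy of `A`. -/
def diamondValues {a b : Type*} [Fintype a] [DecidableEq a] [Fintype b] [DecidableEq b]
    (E : Matrix a a ℂ →ₗ[ℂ] Matrix b b ℂ) : Set ℝ :=
  {r | ∃ ρ : Matrix (a × a) (a × a) ℂ, IsState ρ ∧ r = traceNorm (idTensor a E ρ)}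

/-- The diamond norm of `E`. -/
def diamondNorm {a b : Type*} [Fintype a] [DecidableEq a] [Fintype b] [DecidableEq b]
    (E : Matrix a a ℂ →ₗ[ℂ] Matrix b b ℂ) : ℝ :=
  sSup (diamondValues E)

end QuantumMap

end

/-! Grouping the branches of an instrument by sign turns `E = α T` into a splitting `choi E = P - N`
with `P, N ≥ 0` and `tr_B (P + N) = α 1`, and conversely; so `twistedCosts E = sdpValues E`, and
what remains is duality for the semidefinite program.

Weak duality: a feasible pair writes `(id ⊗ E) ρ` as a difference of positive operators whose traces
add up to `α`, so its trace norm is at most `α` (`diamondValues_le_sdpValues`).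

Strong duality: fix an invertible state `ρ = Sᴴ S` on `A`. The Jordan decomposition of `(S ⊗ 1) J (S
⊗ 1)ᴴ`, conjugated back by `S⁻¹ ⊗ 1`, splits `J` so that `tr (ρ tr_B (P + N))` is the trace norm of
the output of `E` on the pure state `(S ⊗ 1)|Γ⟩`, hence at most the diamond norm
(`exists_decomposition_of_posDef`). The splitting depends on `ρ`; Sion's minimax theorem gives, for
each `r > ‖E‖_⋄`, one that works for all `ρ`, i.e. `tr_B (P + N) ≤ r 1`. Padding turns this into an
equality, and compactness of the feasible pairs lets `r` descend to the diamond norm. -/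

open scoped ComplexOrder Kronecker

noncomputable section

namespace QuantumMap

/-! ### Positive matrices, trace norm and Jordan decomposition -/

section MatrixFacts

open Matrix

open scoped MatrixOrder in
theorem posSemidef_exists_conjTranspose_mul {c : Type*} [Fintype c] {M : Matrix c c ℂ} (hM : M.PosSemidef) :
    ∃ L : Matrix c c ℂ, M = Lᴴ * L := by
  classical
  exact CStarAlgebra.nonneg_iff_eq_star_mul_self.1 (nonneg_iff_posSemidef.2 hM)

theorem trace_mul_nonneg {c : Type*} [Fintype c] {A B : Matrix c c ℂ} (hA : A.PosSemidef) (hB : B.PosSemidef) :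
    0 ≤ (A * B).trace := by
  obtain ⟨L, rfl⟩ := posSemidef_exists_conjTranspose_mul hB
  rw [← Matrix.mul_assoc, Matrix.trace_mul_cycle]
  exact (hA.mul_mul_conjTranspose_same L).trace_nonneg

/-- Entries of `Lᴴ * L` are inner products of columns of `L`, whose squared norms sum to the trace.
All compactness below rests on this bound. -/
theorem norm_apply_le_trace {c : Type*} [Fintype c] {A : Matrix c c ℂ} (hA : A.PosSemidef) (i j : c) :
    ‖A i j‖ ≤ A.trace.re := by
  obtain ⟨L, rfl⟩ := posSemidef_exists_conjTranspose_mul hA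
  have hcol : ∀ i, ∑ k, ‖L k i‖ ^ 2 ≤ (Lᴴ * L).trace.re := by
    intro i
    have h : (Lᴴ * L).trace.re = ∑ i, ∑ k, ‖L k i‖ ^ 2 := by
      simp only [Matrix.trace, Matrix.diag, Matrix.mul_apply, Matrix.conjTranspose_apply,
        Complex.re_sum]
      refine Finset.sum_congr rfl fun i _ => Finset.sum_congr rfl fun k _ => ?_
      rw [Complex.star_def, Complex.conj_mul']
      norm_cast
    rw [h]
    exact Finset.single_le_sum (f := fun i => ∑ k, ‖L k i‖ ^ 2)
      (fun _ _ => by positivity) (Finset.mem_univ i)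
  calc ‖(Lᴴ * L) i j‖ ≤ ∑ k, ‖L k i‖ * ‖L k j‖ := by
        rw [Matrix.mul_apply]
        refine (norm_sum_le _ _).trans_eq ?_
        simp
    _ ≤ ∑ k, (‖L k i‖ ^ 2 + ‖L k j‖ ^ 2) / 2 := by
        refine Finset.sum_le_sum fun k _ => ?_
        nlinarith [sq_nonneg (‖L k i‖ - ‖L k j‖)]
    _ = (∑ k, ‖L k i‖ ^ 2 + ∑ k, ‖L k j‖ ^ 2) / 2 := by
        rw [← Finset.sum_div, Finset.sum_add_distrib]
    _ ≤ _ := by linarith [hcol i, hcol j]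

variable {c : Type*} [Fintype c] [DecidableEq c]

theorem traceNorm_eq_sum_abs_eigenvalues {X : Matrix c c ℂ} (hX : X.IsHermitian) :
    traceNorm X = ∑ i, |hX.eigenvalues i| := by
  set hXX := Matrix.isHermitian_conjTranspose_mul_self X
  have hchar : (Xᴴ * X).charpoly
      = (diagonal (fun i => ((hX.eigenvalues i ^ 2 : ℝ) : ℂ))).charpoly := by
    set V := hX.eigenvectorUnitary
    have h1 : X = (V : Matrix c c ℂ) * diagonal (RCLike.ofReal ∘ hX.eigenvalues)
        * (star V : Matrix c c ℂ) := by
      conv_lhs => rw [hX.spectral_theorem, Unitary.conjStarAlgAut_apply]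
    have h2 : Xᴴ * X = (V : Matrix c c ℂ) *
        (diagonal (fun i => ((hX.eigenvalues i ^ 2 : ℝ) : ℂ)) * (star V : Matrix c c ℂ)) := by
      rw [hX.eq]
      conv_lhs => rw [h1]
      have h3 : (star V : Matrix c c ℂ) * (V : Matrix c c ℂ) = 1 := Unitary.coe_star_mul_self V
      calc _ = (V : Matrix c c ℂ) * diagonal (RCLike.ofReal ∘ hX.eigenvalues) *
            ((star V : Matrix c c ℂ) * (V : Matrix c c ℂ)) *
            (diagonal (RCLike.ofReal ∘ hX.eigenvalues) * (star V : Matrix c c ℂ)) := by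
              simp only [Matrix.mul_assoc]
        _ = _ := by
              rw [h3, Matrix.mul_one, Matrix.mul_assoc, ← Matrix.mul_assoc (diagonal _),
                diagonal_mul_diagonal]
              simp [sq]
    rw [h2, charpoly_mul_comm, Matrix.mul_assoc]
    simp
  have hroots := hXX.roots_charpoly_eq_eigenvalues
  rw [hchar, charpoly_diagonal, Polynomial.roots_prod _ _
    (Finset.prod_ne_zero_iff.2 fun _ _ => Polynomial.X_sub_C_ne_zero _)] at hroots
  -- The two eigenvalue families agree only as multisets, which suffices for a symmetric sum.
  have h := congrArg (fun s : Multiset ℂ => (s.map fun z => √z.re).sum) hroots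
  simp only [Polynomial.roots_X_sub_C, Multiset.bind_singleton, Multiset.map_map,
    Function.comp_def, Complex.ofReal_re, RCLike.ofReal_eq_complex_ofReal] at h
  simpa [traceNorm, Real.sqrt_sq_eq_abs] using h.symm

/-- The Jordan decomposition `X = P - N` of a Hermitian matrix, together with its sign `U`, a
contraction with `tr (U X) = ‖X‖₁`. -/
theorem exists_jordan_decomposition {X : Matrix c c ℂ} (hX : X.IsHermitian) :
    ∃ P N U : Matrix c c ℂ, P.PosSemidef ∧ N.PosSemidef ∧ X = P - N ∧
      (1 - U).PosSemidef ∧ (1 + U).PosSemidef ∧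
      (P.trace + N.trace).re = traceNorm X ∧ (U * X).trace.re = traceNorm X := by
  rw [traceNorm_eq_sum_abs_eigenvalues hX]
  set V := hX.eigenvectorUnitary
  set l := hX.eigenvalues
  have hV : (star V : Matrix c c ℂ) * (V : Matrix c c ℂ) = 1 := Unitary.coe_star_mul_self V
  have hV' : (V : Matrix c c ℂ) * (star V : Matrix c c ℂ) = 1 := Unitary.coe_mul_star_self V
  -- Functional calculus in the eigenbasis of `X`: the witnesses are `D` of the positive part,
  -- negative part and sign of the eigenvalues.
  let D : (c → ℝ) → Matrix c c ℂ := fun f =>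
    (V : Matrix c c ℂ) * diagonal (fun i => (f i : ℂ)) * (star V : Matrix c c ℂ)
  have hX' : X = D l := by
    conv_lhs => rw [hX.spectral_theorem, Unitary.conjStarAlgAut_apply]
    rfl
  have hpos : ∀ f, (∀ i, 0 ≤ f i) → (D f).PosSemidef := fun f hf =>
    (PosSemidef.diagonal (d := fun i => (f i : ℂ))
      (fun i => by simpa using hf i)).mul_mul_conjTranspose_same (V : Matrix c c ℂ)
  have hadd : ∀ f g, D (f + g) = D f + D g := by
    intro f g
    simp only [D, ← Matrix.add_mul, ← Matrix.mul_add, diagonal_add]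
    simp
  have hsub : ∀ f g, D (f - g) = D f - D g := by
    intro f g
    rw [eq_sub_iff_add_eq, ← hadd, sub_add_cancel]
  have hone : D 1 = 1 := by
    simp [D, hV']
  have hmul : ∀ f g, D f * D g = D (f * g) := by
    intro f g
    calc D f * D g = (V : Matrix c c ℂ) * diagonal (fun i => (f i : ℂ)) *
          ((star V : Matrix c c ℂ) * (V : Matrix c c ℂ)) * diagonal (fun i => (g i : ℂ)) *
          (star V : Matrix c c ℂ) := by simp only [D, Matrix.mul_assoc]
      _ = _ := by
        rw [hV, Matrix.mul_one, Matrix.mul_assoc (V : Matrix c c ℂ), diagonal_mul_diagonal]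
        simp [D]
  have htr : ∀ f, (D f).trace.re = ∑ i, f i := by
    intro f
    simp only [D]
    rw [trace_mul_cycle, hV, Matrix.one_mul, trace_diagonal]
    simp
  refine ⟨D (fun i => (l i)⁺), D (fun i => (l i)⁻), D (fun i => (SignType.sign (l i) : ℝ)),
    hpos _ fun i => posPart_nonneg _, hpos _ fun i => negPart_nonneg _, ?_, ?_, ?_, ?_, ?_⟩
  · rw [← hsub, hX']
    congr 1
    funext i
    exact (posPart_sub_negPart _).symm
  · rw [← hone, ← hsub]
    refine hpos _ fun i => ?_
    rcases lt_trichotomy (l i) 0 with h | h | h <;> simp [h]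
  · rw [← hone, ← hadd]
    refine hpos _ fun i => ?_
    rcases lt_trichotomy (l i) 0 with h | h | h <;> simp [h]
  · rw [Complex.add_re, htr, htr, ← Finset.sum_add_distrib]
    exact Finset.sum_congr rfl fun i _ => posPart_add_negPart _
  · rw [show D (fun i => (SignType.sign (l i) : ℝ)) * X =
      D (fun i => (SignType.sign (l i) : ℝ)) * D l from congrArg _ hX', hmul, htr]
    exact Finset.sum_congr rfl fun i _ => by simp

/-- Pair `P - N` with its sign `U`: since `-1 ≤ U ≤ 1`, `tr (U P) ≤ tr P` and `-tr (U N) ≤ tr N`. -/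
theorem traceNorm_sub_le {P N : Matrix c c ℂ} (hP : P.PosSemidef) (hN : N.PosSemidef) :
    traceNorm (P - N) ≤ (P.trace + N.trace).re := by
  obtain ⟨-, -, U, -, -, -, h1, h2, -, h⟩ :=
    exists_jordan_decomposition (hP.isHermitian.sub hN.isHermitian)
  have e1 := (Complex.le_def.1 (trace_mul_nonneg h1 hP)).1
  have e2 := (Complex.le_def.1 (trace_mul_nonneg h2 hN)).1
  simp only [Matrix.sub_mul, Matrix.add_mul, Matrix.one_mul, trace_sub, trace_add,
    Complex.sub_re, Complex.add_re, Complex.zero_re] at e1 e2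
  rw [← h, Matrix.mul_sub, trace_sub, Complex.sub_re, Complex.add_re]
  linarith

theorem re_trace_mul_le_traceNorm {X U : Matrix c c ℂ} (hX : X.IsHermitian)
    (h1 : (1 - U).PosSemidef) (h2 : (1 + U).PosSemidef) : (U * X).trace.re ≤ traceNorm X := by
  obtain ⟨P, N, -, hP, hN, hPN, -, -, h, -⟩ := exists_jordan_decomposition hX
  have e1 := (Complex.le_def.1 (trace_mul_nonneg h1 hP)).1
  have e2 := (Complex.le_def.1 (trace_mul_nonneg h2 hN)).1
  simp only [Matrix.sub_mul, Matrix.add_mul, Matrix.one_mul, trace_sub, trace_add,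
    Complex.sub_re, Complex.add_re, Complex.zero_re] at e1 e2
  rw [← h, hPN, Matrix.mul_sub, trace_sub, Complex.sub_re, Complex.add_re]
  linarith

end MatrixFacts

/-! ### The Choi correspondence and partial traces -/

section Choi

open Matrix

variable {a b k : Type*}

/-- The map with Choi operator `M`. -/
def ofChoi [Fintype a] (M : Matrix (a × b) (a × b) ℂ) : Matrix a a ℂ →ₗ[ℂ] Matrix b b ℂ where
  toFun X := Matrix.of fun x y => ∑ i, ∑ j, X i j * M (i, x) (j, y)
  map_add' X Y := by
    ext x y
    simp [add_mul, Finset.sum_add_distrib]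
  map_smul' r X := by
    ext x y
    simp [mul_assoc, Finset.mul_sum]

theorem ofChoi_apply [Fintype a] (M : Matrix (a × b) (a × b) ℂ) (X : Matrix a a ℂ) (x y : b) :
    ofChoi M X x y = ∑ i, ∑ j, X i j * M (i, x) (j, y) := rfl

theorem ofChoi_add [Fintype a] (M N : Matrix (a × b) (a × b) ℂ) :
    ofChoi (M + N) = ofChoi M + ofChoi N := by
  refine LinearMap.ext fun X => ?_
  ext x y
  simp [ofChoi_apply, mul_add, Finset.sum_add_distrib]

theorem ofChoi_sub [Fintype a] (M N : Matrix (a × b) (a × b) ℂ) :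
    ofChoi (M - N) = ofChoi M - ofChoi N := by
  refine LinearMap.ext fun X => ?_
  ext x y
  simp [ofChoi_apply, mul_sub]

theorem idTensor_apply (E : Matrix a a ℂ →ₗ[ℂ] Matrix b b ℂ) (X : Matrix (k × a) (k × a) ℂ)
    (p q : k × b) :
    idTensor k E X p q = E (Matrix.of fun x y => X (p.1, x) (q.1, y)) p.2 q.2 := rfl

theorem idTensor_sub (E F : Matrix a a ℂ →ₗ[ℂ] Matrix b b ℂ) (X : Matrix (k × a) (k × a) ℂ) :
    idTensor k (E - F) X = idTensor k E X - idTensor k F X := rfl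

theorem idTensor_add (E F : Matrix a a ℂ →ₗ[ℂ] Matrix b b ℂ) (X : Matrix (k × a) (k × a) ℂ) :
    idTensor k (E + F) X = idTensor k E X + idTensor k F X := rfl

theorem partialTraceRight_add [Fintype b] (M N : Matrix (a × b) (a × b) ℂ) :
    partialTraceRight (M + N) = partialTraceRight M + partialTraceRight N := by
  ext i j
  simp [partialTraceRight, Finset.sum_add_distrib]

theorem partialTraceRight_smul [Fintype b] (r : ℂ) (M : Matrix (a × b) (a × b) ℂ) :
    partialTraceRight (r • M) = r • partialTraceRight M := by
  ext i j
  simp [partialTraceRight, Finset.mul_sum]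

theorem trace_partialTraceRight [Fintype a] [Fintype b] (M : Matrix (a × b) (a × b) ℂ) :
    (partialTraceRight M).trace = M.trace := by
  simp [partialTraceRight, Matrix.trace, Fintype.sum_prod_type]

theorem partialTraceRight_kronecker [Fintype b] (R : Matrix a a ℂ) (S : Matrix b b ℂ) :
    partialTraceRight (R ⊗ₖ S) = S.trace • R := by
  ext i j
  simp [partialTraceRight, Matrix.trace, ← Finset.mul_sum, mul_comm]

theorem partialTraceRight_isHermitian [Fintype b] {M : Matrix (a × b) (a × b) ℂ}
    (hM : M.IsHermitian) : (partialTraceRight M).IsHermitian := by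
  ext i j
  simp only [partialTraceRight, Matrix.conjTranspose_apply, Matrix.of_apply, star_sum]
  exact Finset.sum_congr rfl fun x _ => hM.apply _ _

theorem kronecker_one_mul_mul_apply [Fintype a] [Fintype b] [DecidableEq b] (S : Matrix a a ℂ)
    (M : Matrix (a × b) (a × b) ℂ) (p q : a × b) :
    ((S ⊗ₖ (1 : Matrix b b ℂ)) * M * (S ⊗ₖ (1 : Matrix b b ℂ))ᴴ) p q =
      ∑ i, ∑ j, S p.1 i * star (S q.1 j) * M (i, p.2) (j, q.2) := by
  simp only [Matrix.mul_apply, Matrix.kroneckerMap_apply, Matrix.conjTranspose_apply,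
    Fintype.sum_prod_type, Matrix.one_apply, mul_ite, mul_one, mul_zero, ite_mul, zero_mul,
    Finset.sum_ite_eq, Finset.mem_univ, if_true, apply_ite star, star_zero]
  rw [Finset.sum_comm]
  refine Finset.sum_congr rfl fun j _ => ?_
  rw [Finset.sum_mul]
  exact Finset.sum_congr rfl fun i _ => by ring

theorem trace_mul_partialTraceRight [Fintype a] [Fintype b] [DecidableEq b] (S : Matrix a a ℂ)
    (M : Matrix (a × b) (a × b) ℂ) :
    ((S ⊗ₖ (1 : Matrix b b ℂ)) * M * (S ⊗ₖ (1 : Matrix b b ℂ))ᴴ).trace =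
      (Sᴴ * S * partialTraceRight M).trace := by
  have h : partialTraceRight ((S ⊗ₖ (1 : Matrix b b ℂ)) * M * (S ⊗ₖ (1 : Matrix b b ℂ))ᴴ) =
      S * partialTraceRight M * Sᴴ := by
    ext p q
    have hl : partialTraceRight ((S ⊗ₖ (1 : Matrix b b ℂ)) * M * (S ⊗ₖ (1 : Matrix b b ℂ))ᴴ) p q =
        ∑ x, ∑ i, ∑ j, S p i * star (S q j) * M (i, x) (j, x) :=
      Finset.sum_congr rfl fun x _ => kronecker_one_mul_mul_apply S M (p, x) (q, x)
    have hr : (S * partialTraceRight M * Sᴴ) p q =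
        ∑ j, ∑ i, ∑ x, S p i * star (S q j) * M (i, x) (j, x) := by
      simp only [Matrix.mul_apply, partialTraceRight, Matrix.of_apply, Matrix.conjTranspose_apply]
      refine Finset.sum_congr rfl fun j _ => ?_
      rw [Finset.sum_mul]
      refine Finset.sum_congr rfl fun i _ => ?_
      rw [Finset.mul_sum, Finset.sum_mul]
      exact Finset.sum_congr rfl fun x _ => by ring
    rw [hl, hr, Finset.sum_comm, Finset.sum_comm (s := (Finset.univ : Finset a))
      (t := (Finset.univ : Finset a))]
    exact Finset.sum_congr rfl fun i _ => Finset.sum_comm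
  rw [← trace_partialTraceRight, h, Matrix.trace_mul_cycle]

/-- The output is a compression of `X ⊗ M`: `Z` keeps the entries where the `A` indices of `X` and
`M` agree, and conjugation by `W` sums over that shared index. -/
theorem idTensor_ofChoi_posSemidef [Fintype a] [Fintype b] [Fintype k]
    {M : Matrix (a × b) (a × b) ℂ} (hM : M.PosSemidef) {X : Matrix (k × a) (k × a) ℂ}
    (hX : X.PosSemidef) : (idTensor k (ofChoi M) X).PosSemidef := by
  classical
  let Z := (X ⊗ₖ M).submatrix (fun p : (k × b) × a => ((p.1.1, p.2), (p.2, p.1.2)))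
    (fun p : (k × b) × a => ((p.1.1, p.2), (p.2, p.1.2)))
  have hZ : Z.PosSemidef := (hX.kronecker hM).submatrix _
  let W : Matrix (k × b) ((k × b) × a) ℂ := Matrix.of fun p q => if p = q.1 then 1 else 0
  have h : idTensor k (ofChoi M) X = W * Z * Wᴴ := by
    ext p q
    have h1 : ∀ s, (W * Z) p s = ∑ i, Z (p, i) s := by
      intro s
      rw [Matrix.mul_apply, Fintype.sum_prod_type, Finset.sum_comm]
      simp [W]
    have h2 : (W * Z * Wᴴ) p q = ∑ j, (W * Z) p (q, j) := by
      rw [Matrix.mul_apply, Fintype.sum_prod_type, Finset.sum_comm]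
      simp [W, apply_ite star]
    rw [h2, idTensor_apply, ofChoi_apply, Finset.sum_comm]
    refine Finset.sum_congr rfl fun j _ => ?_
    rw [h1]
    rfl
  rw [h]
  exact hZ.mul_mul_conjTranspose_same W

theorem ofChoi_isCompletelyPositive [Fintype a] [Fintype b] {M : Matrix (a × b) (a × b) ℂ}
    (hM : M.PosSemidef) : IsCompletelyPositive (ofChoi M) :=
  fun _ _ hX => idTensor_ofChoi_posSemidef hM hX

theorem IsCompletelyPositive.posSemidef [Fintype a]
    {E : Matrix a a ℂ →ₗ[ℂ] Matrix b b ℂ} (hE : IsCompletelyPositive E) {X : Matrix a a ℂ}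
    (hX : X.PosSemidef) : (E X).PosSemidef :=
  (hE 1 (X.submatrix Prod.snd Prod.snd) (hX.submatrix _)).submatrix (fun x => ((0 : Fin 1), x))

theorem IsHermitianPreserving.map_conjTranspose {E : Matrix a a ℂ →ₗ[ℂ] Matrix b b ℂ}
    (hE : IsHermitianPreserving E) (X : Matrix a a ℂ) : E Xᴴ = (E X)ᴴ := by
  -- The hypothesis covers Hermitian inputs only; `X + Xᴴ` and `i (X - Xᴴ)` are Hermitian and
  -- determine `X`.
  have h1 := (hE (X + Xᴴ) (by simp [Matrix.IsHermitian, add_comm])).eq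
  have h2 := (hE (Complex.I • (X - Xᴴ)) (by simp [Matrix.IsHermitian, ← smul_neg])).eq
  simp only [map_add, map_smul, map_sub, Matrix.conjTranspose_add, Matrix.conjTranspose_sub,
    Matrix.conjTranspose_smul, Complex.star_def, Complex.conj_I, neg_smul, ← smul_neg] at h1 h2
  have h3 := smul_right_injective _ Complex.I_ne_zero h2
  ext i j
  have e1 := congrFun (congrFun h1 i) j
  have e3 := congrFun (congrFun h3 i) j
  simp only [Matrix.add_apply, Matrix.neg_apply, Matrix.sub_apply] at e1 e3
  linear_combination (e3 - e1) / 2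

theorem isHermitianPreserving_idTensor {E : Matrix a a ℂ →ₗ[ℂ] Matrix b b ℂ}
    (hE : IsHermitianPreserving E) : IsHermitianPreserving (idTensor k E) := by
  intro X hX
  ext p q
  rw [Matrix.conjTranspose_apply, idTensor_apply, idTensor_apply, ← Matrix.conjTranspose_apply,
    ← hE.map_conjTranspose]
  refine congrFun (congrFun (congrArg E ?_) _) _
  ext x y
  exact hX.apply _ _

variable [DecidableEq a]

theorem choi_apply (E : Matrix a a ℂ →ₗ[ℂ] Matrix b b ℂ) (p q : a × b) :
    choi E p q = E (Matrix.single p.1 q.1 1) p.2 q.2 := by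
  have h : (Matrix.of fun x y => Matrix.vecMulVec (maxEntangled a) (star (maxEntangled a))
      (p.1, x) (q.1, y)) = Matrix.single p.1 q.1 1 := by
    ext x y
    simp [maxEntangled, Matrix.vecMulVec_apply, Matrix.single_apply, ← ite_and, and_comm]
  rw [choi, idTensor_apply, h]

theorem choi_ofChoi [Fintype a] (M : Matrix (a × b) (a × b) ℂ) : choi (ofChoi M) = M := by
  ext p q
  simp [choi_apply, ofChoi_apply, Matrix.single_apply, ite_and]

theorem ofChoi_choi [Fintype a] (E : Matrix a a ℂ →ₗ[ℂ] Matrix b b ℂ) : ofChoi (choi E) = E := by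
  refine LinearMap.ext fun X => ?_
  ext x y
  conv_rhs => rw [Matrix.matrix_eq_sum_single X]
  simp only [ofChoi_apply, choi_apply, map_sum, Matrix.sum_apply]
  refine Finset.sum_congr rfl fun i _ => Finset.sum_congr rfl fun j _ => ?_
  rw [← mul_one (X i j), ← smul_eq_mul (X i j) 1, ← Matrix.smul_single, map_smul]
  simp

theorem choi_smul (r : ℂ) (E : Matrix a a ℂ →ₗ[ℂ] Matrix b b ℂ) : choi (r • E) = r • choi E := by
  ext p q
  simp [choi_apply]

theorem choi_sum {ι : Type*} (s : Finset ι) (E : ι → Matrix a a ℂ →ₗ[ℂ] Matrix b b ℂ) :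
    choi (∑ j ∈ s, E j) = ∑ j ∈ s, choi (E j) := by
  ext p q
  simp [choi_apply, Matrix.sum_apply]

theorem trace_apply [Fintype a] [Fintype b] (E : Matrix a a ℂ →ₗ[ℂ] Matrix b b ℂ)
    (X : Matrix a a ℂ) :
    (E X).trace = ∑ i, ∑ j, X i j * partialTraceRight (choi E) i j := by
  conv_lhs => rw [← ofChoi_choi E]
  simp only [Matrix.trace, Matrix.diag, ofChoi_apply, partialTraceRight, Matrix.of_apply,
    Finset.mul_sum]
  rw [Finset.sum_comm]
  exact Finset.sum_congr rfl fun i _ => Finset.sum_comm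

theorem trace_apply_of_partialTraceRight [Fintype a] [Fintype b]
    {E : Matrix a a ℂ →ₗ[ℂ] Matrix b b ℂ} {r : ℂ} (h : partialTraceRight (choi E) = r • 1)
    (X : Matrix a a ℂ) : (E X).trace = r * X.trace := by
  rw [trace_apply, h]
  simp [Matrix.one_apply, Matrix.trace, Finset.mul_sum, mul_comm]

theorem IsTracePreserving.partialTraceRight_choi [Fintype a] [Fintype b]
    {E : Matrix a a ℂ →ₗ[ℂ] Matrix b b ℂ} (h : IsTracePreserving E) :
    partialTraceRight (choi E) = 1 := by
  ext i j
  have h1 := h (Matrix.single i j 1)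
  simp only [Matrix.trace, Matrix.diag] at h1
  simp only [partialTraceRight, choi_apply, Matrix.of_apply, h1]
  simp [Matrix.single_apply, Matrix.one_apply, ite_and, eq_comm]

theorem trace_idTensor_of_partialTraceRight [Fintype a] [Fintype b] [Fintype k]
    {E : Matrix a a ℂ →ₗ[ℂ] Matrix b b ℂ} {r : ℂ} (h : partialTraceRight (choi E) = r • 1)
    (X : Matrix (k × a) (k × a) ℂ) : (idTensor k E X).trace = r * X.trace := by
  simp only [Matrix.trace, Matrix.diag, Fintype.sum_prod_type, idTensor_apply]
  rw [Finset.mul_sum]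
  exact Finset.sum_congr rfl fun i _ => trace_apply_of_partialTraceRight h _

theorem IsCompletelyPositive.choi_posSemidef [Fintype a]
    {E : Matrix a a ℂ →ₗ[ℂ] Matrix b b ℂ} (hE : IsCompletelyPositive E) :
    (choi E).PosSemidef := by
  -- Complete positivity is tested on ancillas `Fin k`, so the reference copy of `A` is relabelled.
  let e := Fintype.equivFin a
  have h := (hE (Fintype.card a) _
    ((Matrix.posSemidef_vecMulVec_self_star (maxEntangled a)).submatrix
      (Prod.map e.symm id))).submatrix (Prod.map e id)
  convert h using 1
  ext p q
  simp [choi, idTensor_apply]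

theorem choi_isHermitian [Fintype a] {E : Matrix a a ℂ →ₗ[ℂ] Matrix b b ℂ} (hE : IsHermitianPreserving E) :
    (choi E).IsHermitian :=
  isHermitianPreserving_idTensor hE _ (Matrix.posSemidef_vecMulVec_self_star _).isHermitian

/-- The vector with amplitudes `S` is `(S ⊗ 1)|Γ⟩`, and `S` acts on the reference, where it commutes
with `id ⊗ E`. -/
theorem idTensor_vecMulVec [Fintype a] [Fintype b] [DecidableEq b]
    (E : Matrix a a ℂ →ₗ[ℂ] Matrix b b ℂ) (S : Matrix a a ℂ) :
    idTensor a E (Matrix.vecMulVec (fun p : a × a => S p.1 p.2)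
      (star fun p : a × a => S p.1 p.2)) =
      (S ⊗ₖ (1 : Matrix b b ℂ)) * choi E * (S ⊗ₖ (1 : Matrix b b ℂ))ᴴ := by
  ext p q
  rw [kronecker_one_mul_mul_apply, idTensor_apply]
  conv_lhs => rw [← ofChoi_choi E]
  simp [ofChoi_apply, Matrix.vecMulVec_apply]

end Choi

/-! ### Compactness of states and Hermitian contractions -/

section Compactness

open Matrix

theorem isClosed_setOf_posSemidef (c : Type*) [Fintype c] :
    IsClosed {M : Matrix c c ℂ | M.PosSemidef} := by
  have h : {M : Matrix c c ℂ | M.PosSemidef} =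
      {M | Mᴴ = M} ∩ ⋂ x : c → ℂ, {M | 0 ≤ star x ⬝ᵥ M *ᵥ x} := by
    ext M
    simp [Matrix.posSemidef_iff_dotProduct_mulVec, Matrix.IsHermitian]
  rw [h]
  refine (isClosed_eq (by fun_prop) continuous_id).inter (isClosed_iInter fun x => ?_)
  exact isClosed_le continuous_const (by fun_prop)

theorem isCompact_setOf_norm_apply_le (m n : Type*) (K : ℝ) :
    IsCompact {M : Matrix m n ℂ | ∀ i j, ‖M i j‖ ≤ K} := by
  have h := isCompact_univ_pi fun _ : m => isCompact_univ_pi fun _ : n =>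
    isCompact_closedBall (0 : ℂ) K
  have e : {M : Matrix m n ℂ | ∀ i j, ‖M i j‖ ≤ K} =
      Set.univ.pi fun _ : m => Set.univ.pi fun _ : n => Metric.closedBall (0 : ℂ) K := by
    ext M
    exact ⟨fun h i _ j _ => by simpa using h i j, fun h i j => by simpa using h i trivial j trivial⟩
  rw [e]
  exact h

theorem isCompact_setOf_isState (c : Type*) [Fintype c] :
    IsCompact {ρ : Matrix c c ℂ | IsState ρ} := by
  refine (isCompact_setOf_norm_apply_le c c 1).of_isClosed_subset
    ((isClosed_setOf_posSemidef c).inter (isClosed_eq (f := Matrix.trace) (g := fun _ => (1 : ℂ))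
      (by fun_prop) continuous_const)) ?_
  rintro ρ ⟨h1, h2⟩ i j
  simpa [h2] using norm_apply_le_trace h1 i j

theorem isCompact_setOf_contraction (c : Type*) [Fintype c] [DecidableEq c] :
    IsCompact {U : Matrix c c ℂ | (1 - U).PosSemidef ∧ (1 + U).PosSemidef} := by
  -- `1 - U ≥ 0` bounds `tr (1 + U)` by twice the dimension, hence the entries of `1 + U`; removing
  -- `1` costs at most one more.
  refine (isCompact_setOf_norm_apply_le c c (2 * Fintype.card c + 1)).of_isClosed_subset
    (((isClosed_setOf_posSemidef c).preimage (by fun_prop : Continuous fun U : Matrix c c ℂ => 1 - U)).inter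
      ((isClosed_setOf_posSemidef c).preimage (by fun_prop : Continuous fun U : Matrix c c ℂ => 1 + U))) ?_
  rintro U ⟨h1, h2⟩ i j
  have h1t := (Complex.le_def.1 (Matrix.PosSemidef.trace_nonneg h1)).1
  have h2t := norm_apply_le_trace h2 i j
  simp only [Matrix.trace_sub, Matrix.trace_add, Matrix.trace_one, Complex.sub_re, Complex.add_re,
    Complex.natCast_re, Complex.zero_re] at h1t h2t
  have h3 : ‖(1 : Matrix c c ℂ) i j‖ ≤ 1 := by
    rw [Matrix.one_apply]
    split_ifs <;> simp
  calc ‖U i j‖ = ‖(1 + U) i j - (1 : Matrix c c ℂ) i j‖ := by simp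
    _ ≤ ‖(1 + U) i j‖ + ‖(1 : Matrix c c ℂ) i j‖ := norm_sub_le _ _
    _ ≤ _ := by linarith

theorem isState_maximallyMixed (c : Type*) [Fintype c] [DecidableEq c] [Nonempty c] :
    IsState (((Fintype.card c : ℂ)⁻¹) • (1 : Matrix c c ℂ)) := by
  refine ⟨Matrix.PosSemidef.one.smul (by simp), ?_⟩
  simp

end Compactness

/-! ### Attainment of the diamond norm, weak duality, splittings for a fixed state -/

section Duality

open Matrix

variable {a b : Type*} [Fintype a] [DecidableEq a] [Fintype b] [DecidableEq b]

/-- The trace norm is itself a maximum over `-1 ≤ U ≤ 1`, so `tr (U (id ⊗ E) ρ)` is maximized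
jointly over a compact product; continuity of `traceNorm` is not needed. -/
theorem isGreatest_diamondValues [Nonempty a] {E : Matrix a a ℂ →ₗ[ℂ] Matrix b b ℂ}
    (hE : IsHermitianPreserving E) : IsGreatest (diamondValues E) (diamondNorm E) := by
  have hcont : Continuous fun p : Matrix (a × a) (a × a) ℂ × Matrix (a × b) (a × b) ℂ =>
      (p.2 * idTensor a E p.1).trace.re := by
    have := (idTensor a E).continuous_of_finiteDimensional
    fun_prop
  obtain ⟨⟨ρ, U⟩, ⟨hρ, hU⟩, hmax⟩ := ((isCompact_setOf_isState (a × a)).prod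
    (isCompact_setOf_contraction (a × b))).exists_isMaxOn
    ⟨(_, 0), isState_maximallyMixed (a × a), by simp [Matrix.PosSemidef.one]⟩ hcont.continuousOn
  have hH : ∀ {σ : Matrix (a × a) (a × a) ℂ}, IsState σ → (idTensor a E σ).IsHermitian :=
    fun hσ => isHermitianPreserving_idTensor hE _ hσ.1.isHermitian
  have h : IsGreatest (diamondValues E) (traceNorm (idTensor a E ρ)) := by
    refine ⟨⟨ρ, hρ, rfl⟩, ?_⟩
    rintro _ ⟨σ, hσ, rfl⟩
    obtain ⟨-, -, V, -, -, -, h1, h2, -, h3⟩ := exists_jordan_decomposition (hH hσ)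
    rw [← h3]
    exact (hmax (show (σ, V) ∈ _ from ⟨hσ, h1, h2⟩)).trans
      (re_trace_mul_le_traceNorm (hH hρ) hU.1 hU.2)
  rwa [diamondNorm, h.csSup_eq]

theorem diamondValues_le_sdpValues {E : Matrix a a ℂ →ₗ[ℂ] Matrix b b ℂ} {r α : ℝ}
    (hr : r ∈ diamondValues E) (hα : α ∈ sdpValues E) : r ≤ α := by
  obtain ⟨ρ, hρ, rfl⟩ := hr
  obtain ⟨P, N, hE, hP, hN, hPN⟩ := hα
  rw [← ofChoi_choi E, hE, ofChoi_sub, idTensor_sub]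
  refine (traceNorm_sub_le (idTensor_ofChoi_posSemidef hP hρ.1)
    (idTensor_ofChoi_posSemidef hN hρ.1)).trans_eq ?_
  rw [← Matrix.trace_add, ← idTensor_add, ← ofChoi_add,
    trace_idTensor_of_partialTraceRight (r := α) (by rw [choi_ofChoi, hPN]), hρ.2]
  simp

theorem mem_sdpValues_of_posSemidef [Nonempty b] {E : Matrix a a ℂ →ₗ[ℂ] Matrix b b ℂ}
    {P N : Matrix (a × b) (a × b) ℂ} (hE : choi E = P - N) (hP : P.PosSemidef)
    (hN : N.PosSemidef) {α : ℝ}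
    (h : ((α : ℂ) • (1 : Matrix a a ℂ) - partialTraceRight (P + N)).PosSemidef) :
    α ∈ sdpValues E := by
  set R := (α : ℂ) • (1 : Matrix a a ℂ) - partialTraceRight (P + N)
  -- Half of the slack goes to each of `P` and `N`: the difference is unchanged and `tr_B` of the
  -- sum grows by exactly `R`.
  set Q := R ⊗ₖ ((2 * Fintype.card b : ℂ)⁻¹ • (1 : Matrix b b ℂ))
  have hQ : Q.PosSemidef := h.kronecker (Matrix.PosSemidef.one.smul (by positivity))
  have hb : (Fintype.card b : ℂ) ≠ 0 := by simp
  refine ⟨P + Q, N + Q, by rw [hE]; abel, hP.add hQ, hN.add hQ, ?_⟩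
  rw [show P + Q + (N + Q) = (P + N) + (Q + Q) by abel, partialTraceRight_add,
    partialTraceRight_add Q, partialTraceRight_kronecker, ← add_smul]
  have : (((2 * Fintype.card b : ℂ)⁻¹ • (1 : Matrix b b ℂ)).trace +
      ((2 * Fintype.card b : ℂ)⁻¹ • (1 : Matrix b b ℂ)).trace) = 1 := by
    rw [Matrix.trace_smul, Matrix.trace_one, smul_eq_mul]
    field_simp
    norm_num
  rw [this, one_smul]
  simp [R]

/-- A Hermitian matrix whose expectation in every state is at most `r` is at most `r • 1`. -/
theorem posSemidef_smul_one_sub {X : Matrix a a ℂ} (hX : X.IsHermitian) {r : ℝ}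
    (h : ∀ ρ : Matrix a a ℂ, IsState ρ → (ρ * X).trace.re ≤ r) :
    ((r : ℂ) • (1 : Matrix a a ℂ) - X).PosSemidef := by
  have hH : ((r : ℂ) • (1 : Matrix a a ℂ) - X).IsHermitian := by
    refine Matrix.IsHermitian.sub ?_ hX
    simp [Matrix.IsHermitian, Matrix.conjTranspose_smul]
  refine Matrix.PosSemidef.of_dotProduct_mulVec_nonneg hH fun x => ?_
  have htr : ∀ Y : Matrix a a ℂ,
      star x ⬝ᵥ Y *ᵥ x = (Matrix.vecMulVec x (star x) * Y).trace := by
    intro Y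
    rw [Matrix.vecMulVec_mul, Matrix.trace_vecMulVec, dotProduct_comm x,
      Matrix.dotProduct_mulVec]
  rcases eq_or_ne x 0 with rfl | hx
  · simp
  have hpos : 0 < star x ⬝ᵥ x := by simpa using hx
  obtain ⟨t, ht, hxt⟩ := RCLike.pos_iff_exists_ofReal.1 hpos
  have hxt' : (Matrix.vecMulVec x (star x)).trace = (t : ℂ) := by
    rw [Matrix.trace_vecMulVec, dotProduct_comm]
    exact hxt.symm
  have hst : IsState (((t⁻¹ : ℝ) : ℂ) • Matrix.vecMulVec x (star x)) := by
    refine ⟨(Matrix.posSemidef_vecMulVec_self_star x).smul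
      (Complex.zero_le_real.2 (inv_nonneg.2 ht.le)), ?_⟩
    rw [Matrix.trace_smul, hxt', smul_eq_mul, ← Complex.ofReal_mul, inv_mul_cancel₀ ht.ne',
      Complex.ofReal_one]
  have hle := h _ hst
  rw [Matrix.smul_mul, Matrix.trace_smul, smul_eq_mul, Complex.re_ofReal_mul,
    inv_mul_le_iff₀ ht] at hle
  refine Complex.le_def.2 ⟨?_, (hH.im_star_dotProduct_mulVec_self x).symm⟩
  rw [htr, Matrix.mul_sub, Matrix.trace_sub, Matrix.mul_smul, Matrix.mul_one, Matrix.trace_smul,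
    hxt', smul_eq_mul, ← Complex.ofReal_mul, Complex.sub_re, Complex.ofReal_re, Complex.zero_re]
  linarith

theorem diamondValues_of_factor {E : Matrix a a ℂ →ₗ[ℂ] Matrix b b ℂ} {S : Matrix a a ℂ}
    (hS : (Sᴴ * S).trace = 1) :
    traceNorm ((S ⊗ₖ (1 : Matrix b b ℂ)) * choi E * (S ⊗ₖ (1 : Matrix b b ℂ))ᴴ) ∈
      diamondValues E := by
  refine ⟨_, ⟨Matrix.posSemidef_vecMulVec_self_star (fun p : a × a => S p.1 p.2), ?_⟩,
    by rw [idTensor_vecMulVec]⟩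
  rw [← hS, Matrix.trace_mul_comm]
  simp [Matrix.trace, Matrix.vecMulVec_apply, Matrix.mul_apply, Fintype.sum_prod_type]

/-- Positive definiteness makes the filter `S ⊗ 1` invertible, so a Jordan decomposition of the
filtered Choi operator can be pulled back to the Choi operator itself. -/
theorem exists_decomposition_of_posDef {E : Matrix a a ℂ →ₗ[ℂ] Matrix b b ℂ}
    (hE : IsHermitianPreserving E) {ρ : Matrix a a ℂ} (hρ : ρ.PosDef) (hρ1 : ρ.trace = 1) :
    ∃ P N : Matrix (a × b) (a × b) ℂ, choi E = P - N ∧ P.PosSemidef ∧ N.PosSemidef ∧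
      (ρ * partialTraceRight (P + N)).trace.re ∈ diamondValues E := by
  obtain ⟨S, rfl⟩ := posSemidef_exists_conjTranspose_mul hρ.posSemidef
  have hS : IsUnit S.det := by
    have := (Matrix.isUnit_iff_isUnit_det _).1 hρ.isUnit
    rw [Matrix.det_mul] at this
    exact isUnit_of_mul_isUnit_right this
  set T := S ⊗ₖ (1 : Matrix b b ℂ)
  set T' := S⁻¹ ⊗ₖ (1 : Matrix b b ℂ)
  have hTT : T * T' = 1 := by
    simp [T, T', ← Matrix.mul_kronecker_mul, Matrix.mul_nonsing_inv _ hS]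
  have hTT' : T' * T = 1 := by
    simp [T, T', ← Matrix.mul_kronecker_mul, Matrix.nonsing_inv_mul _ hS]
  have hTT'' : T'ᴴ * Tᴴ = 1 := by
    rw [← Matrix.conjTranspose_mul, hTT, Matrix.conjTranspose_one]
  have hTT''' : Tᴴ * T'ᴴ = 1 := by
    rw [← Matrix.conjTranspose_mul, hTT', Matrix.conjTranspose_one]
  obtain ⟨P, N, -, hP, hN, hPN, -, -, h, -⟩ := exists_jordan_decomposition
    (Matrix.isHermitian_mul_mul_conjTranspose T (choi_isHermitian hE))
  have hcancel : ∀ M : Matrix (a × b) (a × b) ℂ, T * (T' * M * T'ᴴ) * Tᴴ = M := by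
    intro M
    rw [← Matrix.mul_assoc, ← Matrix.mul_assoc, hTT, Matrix.one_mul, Matrix.mul_assoc, hTT'',
      Matrix.mul_one]
  refine ⟨T' * P * T'ᴴ, T' * N * T'ᴴ, ?_, hP.mul_mul_conjTranspose_same _,
    hN.mul_mul_conjTranspose_same _, ?_⟩
  · rw [← Matrix.sub_mul, ← Matrix.mul_sub, ← hPN, ← Matrix.mul_assoc, ← Matrix.mul_assoc, hTT',
      Matrix.one_mul, Matrix.mul_assoc, hTT''', Matrix.mul_one]
  · rw [← trace_mul_partialTraceRight, ← Matrix.add_mul, ← Matrix.mul_add, hcancel,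
      Matrix.trace_add, h]
    exact diamondValues_of_factor hρ1

end Duality

/-! ### Minimax, strong duality and attainment of the program -/

section StrongDuality

open Matrix

variable {a b : Type*}

theorem partialTraceRight_posSemidef [Fintype b] {M : Matrix (a × b) (a × b) ℂ} (hM : M.PosSemidef) :
    (partialTraceRight M).PosSemidef := by
  have h : partialTraceRight M = ∑ x, M.submatrix (fun i => (i, x)) (fun i => (i, x)) := by
    ext i j
    simp [partialTraceRight, Matrix.sum_apply]
  rw [h]
  exact Matrix.posSemidef_sum _ fun x _ => hM.submatrix _

/-- The pairing `(ρ, (P, N)) ↦ -tr (ρ tr_B (P + N))`. -/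
def negPairing (a b : Type*) [Fintype a] [Fintype b] : Matrix a a ℂ →ₗ[ℝ]
    (Matrix (a × b) (a × b) ℂ × Matrix (a × b) (a × b) ℂ) →ₗ[ℝ] ℝ :=
  LinearMap.mk₂ ℝ (fun ρ p => -(ρ * partialTraceRight (p.1 + p.2)).trace.re)
    (fun ρ σ p => by simp only [Matrix.add_mul, Matrix.trace_add, Complex.add_re]; ring)
    (fun r ρ p => by simp)
    (fun ρ p q => by
      rw [show (p + q).1 + (p + q).2 = (p.1 + p.2) + (q.1 + q.2) by
        simp only [Prod.fst_add, Prod.snd_add]; abel, partialTraceRight_add, Matrix.mul_add,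
        Matrix.trace_add, Complex.add_re]
      ring)
    (fun r ρ p => by
      rw [show (r • p).1 + (r • p).2 = (r : ℂ) • (p.1 + p.2) by
        simp only [Prod.smul_fst, Prod.smul_snd, ← smul_add]; rfl, partialTraceRight_smul,
        Matrix.mul_smul, Matrix.trace_smul, smul_eq_mul, Complex.re_ofReal_mul, smul_eq_mul]
      ring)

/-- The pairs of positive semidefinite operators whose difference is the Choi operator. -/
def decompositions [DecidableEq a] (E : Matrix a a ℂ →ₗ[ℂ] Matrix b b ℂ) :
    Set (Matrix (a × b) (a × b) ℂ × Matrix (a × b) (a × b) ℂ) :=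
  {p | choi E = p.1 - p.2 ∧ p.1.PosSemidef ∧ p.2.PosSemidef}

theorem convex_decompositions [DecidableEq a] (E : Matrix a a ℂ →ₗ[ℂ] Matrix b b ℂ) :
    Convex ℝ (decompositions E) := by
  rintro p ⟨h1, h2, h3⟩ q ⟨h4, h5, h6⟩ s t hs ht hst
  refine ⟨?_, (h2.smul hs).add (h5.smul ht), (h3.smul hs).add (h6.smul ht)⟩
  calc choi E = (s + t) • choi E := by rw [hst, one_smul]
    _ = s • (p.1 - p.2) + t • (q.1 - q.2) := by rw [add_smul, ← h1, ← h4]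
    _ = _ := by
      simp only [Prod.fst_add, Prod.snd_add, Prod.smul_fst, Prod.smul_snd, smul_sub]
      abel

theorem convex_setOf_isState (c : Type*) [Fintype c] :
    Convex ℝ {ρ : Matrix c c ℂ | IsState ρ} := by
  rintro ρ ⟨h1, h2⟩ σ ⟨h3, h4⟩ s t hs ht hst
  refine ⟨(h1.smul hs).add (h3.smul ht), ?_⟩
  rw [Matrix.trace_add, Matrix.trace_smul, Matrix.trace_smul, h2, h4]
  simp only [Complex.real_smul, mul_one]
  exact_mod_cast hst

theorem nonneg_of_mem_sdpValues [Nonempty a] [Fintype b] [DecidableEq a]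
    {E : Matrix a a ℂ →ₗ[ℂ] Matrix b b ℂ} {α : ℝ} (hα : α ∈ sdpValues E) : 0 ≤ α := by
  obtain ⟨P, N, -, hP, hN, h⟩ := hα
  have h1 := (partialTraceRight_posSemidef (hP.add hN)).diag_nonneg (i := Classical.arbitrary a)
  rw [h] at h1
  simpa using h1

variable [Fintype a] [Fintype b] [DecidableEq a] [DecidableEq b]

theorem diamondNorm_nonneg [Nonempty a] {E : Matrix a a ℂ →ₗ[ℂ] Matrix b b ℂ}
    (hE : IsHermitianPreserving E) : 0 ≤ diamondNorm E := by
  obtain ⟨ρ, -, h⟩ := (isGreatest_diamondValues hE).1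
  rw [h]
  exact Finset.sum_nonneg fun _ _ => Real.sqrt_nonneg _

theorem exists_decomposition_lt [Nonempty a] {E : Matrix a a ℂ →ₗ[ℂ] Matrix b b ℂ}
    (hE : IsHermitianPreserving E) {ρ : Matrix a a ℂ} (hρ : IsState ρ) {r : ℝ}
    (hr : diamondNorm E < r) :
    ∃ p ∈ decompositions E, (ρ * partialTraceRight (p.1 + p.2)).trace.re < r := by
  have hc := diamondNorm_nonneg hE
  -- Mixing in weight `ε` of the maximally mixed state makes `ρ` invertible. This choice gives `(1 -
  -- ε) r = diamondNorm E + ε`, and the contribution of the mixed part is nonnegative, so it can be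
  -- dropped.
  set ε := (r - diamondNorm E) / (r + 1)
  have hr0 : 0 < r + 1 := by linarith
  have hε : 0 < ε := div_pos (by linarith) hr0
  have hε1 : 0 < 1 - ε := by
    rw [sub_pos, div_lt_one hr0]
    linarith
  have hεr : diamondNorm E < (1 - ε) * r := by
    have : ε * (r + 1) = r - diamondNorm E := div_mul_cancel₀ _ hr0.ne'
    nlinarith
  set μ : Matrix a a ℂ := ((Fintype.card a : ℂ)⁻¹) • (1 : Matrix a a ℂ)
  have hμ : μ.PosDef := Matrix.PosDef.one.smul (by simp [Fintype.card_pos])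
  have hσ : ((1 - ε) • ρ + ε • μ).PosDef :=
    Matrix.PosDef.posSemidef_add (hρ.1.smul hε1.le) (hμ.smul hε)
  have hσ1 := (convex_setOf_isState a hρ (isState_maximallyMixed a) hε1.le hε.le (by ring)).2
  obtain ⟨P, N, hPN, hP, hN, hmem⟩ := exists_decomposition_of_posDef hE hσ hσ1
  refine ⟨(P, N), ⟨hPN, hP, hN⟩, ?_⟩
  have hle := (isGreatest_diamondValues hE).2 hmem
  have h2 : 0 ≤ (μ * partialTraceRight (P + N)).trace.re :=
    (Complex.le_def.1 (trace_mul_nonneg hμ.posSemidef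
      (partialTraceRight_posSemidef (hP.add hN)))).1
  rw [Matrix.add_mul, Matrix.trace_add, Matrix.smul_mul, Matrix.smul_mul, Matrix.trace_smul,
    Matrix.trace_smul, Complex.add_re, Complex.smul_re, Complex.smul_re, smul_eq_mul,
    smul_eq_mul] at hle
  have h3 : 0 ≤ ε * (μ * partialTraceRight (P + N)).trace.re := mul_nonneg hε.le h2
  exact lt_of_mul_lt_mul_left (by linarith) hε1.le

theorem mem_sdpValues_of_diamondNorm_lt [Nonempty a] [Nonempty b]
    {E : Matrix a a ℂ →ₗ[ℂ] Matrix b b ℂ} (hE : IsHermitianPreserving E) {r : ℝ}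
    (hr : diamondNorm E < r) : r ∈ sdpValues E := by
  have hX := isCompact_setOf_isState a
  have hcX : ∀ p, Continuous fun ρ => negPairing a b ρ p := fun p =>
    ((negPairing a b).flip p).continuous_of_finiteDimensional
  have hcY : ∀ ρ, Continuous fun p => negPairing a b ρ p := fun ρ =>
    (negPairing a b ρ).continuous_of_finiteDimensional
  -- By compactness, finitely many splittings already serve all states, the form of hypothesis the
  -- minimax lemma takes. There the compact set is the minimizing side, hence the sign in
  -- `negPairing`.
  obtain ⟨s, hs, hsf, hcov⟩ := hX.elim_finite_subcover_image (b := decompositions E)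
    (c := fun p => {ρ | -r < negPairing a b ρ p})
    (fun p _ => isOpen_lt continuous_const (hcX p)) (by
      intro ρ hρ
      obtain ⟨p, hp, hlt⟩ := exists_decomposition_lt hE hρ hr
      exact Set.mem_biUnion hp (neg_lt_neg hlt))
  obtain ⟨p, hp, hlt⟩ := Sion.exists_lt_iInf_of_lt_iInf_of_finite
    (f := fun ρ p => negPairing a b ρ p) ⟨_, isState_maximallyMixed a⟩ hX
    (fun p _ => (hcX p).lowerSemicontinuous.lowerSemicontinuousOn _)
    (fun p _ => (((negPairing a b).flip p).convexOn (convex_setOf_isState a)).quasiconvexOn)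
    (convex_decompositions E)
    (fun ρ _ => (hcY ρ).upperSemicontinuous.upperSemicontinuousOn _)
    (fun ρ _ => ((negPairing a b ρ).concaveOn (convex_decompositions E)).quasiconcaveOn)
    (convex_setOf_isState a) hsf hs (t := -r) (fun ρ hρ => by
      simpa using hcov hρ)
  refine mem_sdpValues_of_posSemidef hp.1 hp.2.1 hp.2.2 (posSemidef_smul_one_sub
    (partialTraceRight_isHermitian (hp.2.1.add hp.2.2).isHermitian) fun ρ hρ => ?_)
  exact (neg_lt_neg_iff.1 (hlt ρ hρ)).le

theorem exists_isLeast_sdpValues [Nonempty a] [Nonempty b]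
    {E : Matrix a a ℂ →ₗ[ℂ] Matrix b b ℂ} (hE : IsHermitianPreserving E) :
    ∃ α, IsLeast (sdpValues E) α := by
  obtain ⟨β, hβ⟩ : (sdpValues E).Nonempty :=
    ⟨_, mem_sdpValues_of_diamondNorm_lt hE (lt_add_one _)⟩
  -- Tracing `tr_B (P + N) = α 1` recovers `α`, so feasibility becomes a closed condition on the
  -- pair alone; the cutoff `β` then bounds both traces.
  let val : Matrix (a × b) (a × b) ℂ × Matrix (a × b) (a × b) ℂ → ℝ :=
    fun p => (p.1 + p.2).trace.re / Fintype.card a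
  have hval : Continuous val := by fun_prop
  have hptr : Continuous fun p : Matrix (a × b) (a × b) ℂ × Matrix (a × b) (a × b) ℂ =>
      partialTraceRight (p.1 + p.2) := by
    refine continuous_matrix fun i j => ?_
    simp only [partialTraceRight, Matrix.of_apply, Matrix.add_apply]
    fun_prop
  have hcard : (0 : ℝ) < Fintype.card a := by exact_mod_cast Fintype.card_pos
  have hval_eq : ∀ (p : Matrix (a × b) (a × b) ℂ × Matrix (a × b) (a × b) ℂ) (α : ℝ),
      partialTraceRight (p.1 + p.2) = (α : ℂ) • (1 : Matrix a a ℂ) → val p = α := by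
    intro p α h
    have := congrArg (fun M => (Matrix.trace M).re) h
    simp only [trace_partialTraceRight, Matrix.trace_smul, Matrix.trace_one, smul_eq_mul,
      Complex.re_ofReal_mul, Complex.natCast_re] at this
    simp only [val, this]
    field_simp
  let F : Set (Matrix (a × b) (a × b) ℂ × Matrix (a × b) (a × b) ℂ) :=
    {p | (p.1.PosSemidef ∧ p.2.PosSemidef) ∧ choi E = p.1 - p.2 ∧
      partialTraceRight (p.1 + p.2) = (val p : ℂ) • (1 : Matrix a a ℂ) ∧ val p ≤ β}
  have hF : IsCompact F := by
    refine ((isCompact_setOf_norm_apply_le _ _ (β * Fintype.card a)).prod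
      (isCompact_setOf_norm_apply_le _ _ (β * Fintype.card a))).of_isClosed_subset ?_ ?_
    · refine IsClosed.inter (((isClosed_setOf_posSemidef _).preimage continuous_fst).inter
        ((isClosed_setOf_posSemidef _).preimage continuous_snd)) (IsClosed.inter ?_
          (IsClosed.inter ?_ ?_))
      · exact isClosed_eq continuous_const (by fun_prop)
      · exact isClosed_eq hptr (by fun_prop)
      · exact isClosed_le hval continuous_const
    · rintro ⟨P, N⟩ ⟨⟨hP, hN⟩, -, -, h⟩
      have h' := (div_le_iff₀ hcard).1 h
      have hPt := (Complex.le_def.1 hP.trace_nonneg).1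
      have hNt := (Complex.le_def.1 hN.trace_nonneg).1
      simp only [Matrix.trace_add, Complex.add_re, Complex.zero_re] at h' hPt hNt
      exact ⟨fun i j => (norm_apply_le_trace hP i j).trans (by linarith),
        fun i j => (norm_apply_le_trace hN i j).trans (by linarith)⟩
  have hmem : ∀ α ∈ sdpValues E, α ≤ β → ∃ p ∈ F, val p = α := by
    rintro α ⟨P, N, hPN, hP, hN, h⟩ hαβ
    have hv := hval_eq (P, N) α h
    exact ⟨(P, N), ⟨⟨hP, hN⟩, hPN, by rw [hv]; exact h, hv.trans_le hαβ⟩, hv⟩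
  obtain ⟨p₀, hp₀, -⟩ := hmem β hβ le_rfl
  obtain ⟨p, hp, hmin⟩ := hF.exists_isMinOn ⟨p₀, hp₀⟩ hval.continuousOn
  refine ⟨val p, ⟨p.1, p.2, hp.2.1, hp.1.1, hp.1.2, hp.2.2.1⟩, fun α hα => ?_⟩
  rcases le_total α β with h | h
  · obtain ⟨q, hq, rfl⟩ := hmem α hα h
    exact hmin hq
  · exact hp.2.2.2.trans h

theorem isLeast_sdpValues_diamondNorm [Nonempty a] [Nonempty b]
    {E : Matrix a a ℂ →ₗ[ℂ] Matrix b b ℂ} (hE : IsHermitianPreserving E) :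
    IsLeast (sdpValues E) (diamondNorm E) := by
  obtain ⟨α, hα⟩ := exists_isLeast_sdpValues hE
  have h : diamondNorm E = α :=
    le_antisymm (diamondValues_le_sdpValues (isGreatest_diamondValues hE).1 hα.1)
      (le_of_forall_gt_imp_ge_of_dense fun r hr => hα.2 (mem_sdpValues_of_diamondNorm_lt hE hr))
  rwa [h]

end StrongDuality

/-! ### Twisted channels as feasible pairs -/

section TwistedChannels

open Matrix

variable {a b : Type*} [Fintype a] [DecidableEq a] [Fintype b]

theorem twistedCosts_subset_sdpValues (E : Matrix a a ℂ →ₗ[ℂ] Matrix b b ℂ) :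
    twistedCosts E ⊆ sdpValues E := by
  rintro α ⟨hα, _, ⟨n, s, M, hs, ⟨hM, -, htp⟩, rfl⟩, rfl⟩
  have hα' : (0 : ℂ) ≤ (α : ℂ) := Complex.zero_le_real.2 hα
  -- These coefficients are the indicators of the signs `+1` and `-1`.
  have hcoef : ∀ j, (0 : ℂ) ≤ (1 + s j) / 2 ∧ (0 : ℂ) ≤ (1 - s j) / 2 := by
    intro j
    rcases hs j with h | h <;> norm_num [h]
  refine ⟨(α : ℂ) • ∑ j, ((1 + s j) / 2) • choi (M j), (α : ℂ) • ∑ j, ((1 - s j) / 2) • choi (M j),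
    ?_, (Matrix.posSemidef_sum _ fun j _ => (hM j).1.choi_posSemidef.smul (hcoef j).1).smul hα',
    (Matrix.posSemidef_sum _ fun j _ => (hM j).1.choi_posSemidef.smul (hcoef j).2).smul hα', ?_⟩
  · rw [choi_smul, choi_sum, ← smul_sub, ← Finset.sum_sub_distrib]
    congr 1
    refine Finset.sum_congr rfl fun j _ => ?_
    rw [choi_smul, ← sub_smul]
    congr 1
    ring
  · rw [← smul_add, ← Finset.sum_add_distrib, partialTraceRight_smul,
      ← htp.partialTraceRight_choi, choi_sum]
    congr 2
    refine Finset.sum_congr rfl fun j _ => ?_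
    rw [← add_smul, show (1 + s j) / 2 + (1 - s j) / 2 = 1 by ring, one_smul]

/-- Two positive semidefinite operators whose sum is the Choi operator of a channel define a
twisted channel. -/
theorem isTwistedChannel_ofChoi_sub {P N : Matrix (a × b) (a × b) ℂ} (hP : P.PosSemidef)
    (hN : N.PosSemidef) (h : partialTraceRight (P + N) = 1) :
    IsTwistedChannel (ofChoi P - ofChoi N) := by
  have htp : IsTracePreserving (ofChoi P + ofChoi N) := by
    intro X
    rw [← ofChoi_add, trace_apply_of_partialTraceRight (r := 1) (by rw [choi_ofChoi, h, one_smul]),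
      one_mul]
  have htn : ∀ X : Matrix a a ℂ, X.PosSemidef →
      (ofChoi P X).trace.re ≤ X.trace.re ∧ (ofChoi N X).trace.re ≤ X.trace.re := by
    intro X hX
    have h1 := congrArg Complex.re (htp X)
    have h2 := (Complex.le_def.1
      ((ofChoi_isCompletelyPositive hP).posSemidef hX).trace_nonneg).1
    have h3 := (Complex.le_def.1
      ((ofChoi_isCompletelyPositive hN).posSemidef hX).trace_nonneg).1
    rw [LinearMap.add_apply, Matrix.trace_add, Complex.add_re] at h1
    rw [Complex.zero_re] at h2 h3
    constructor <;> linarith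
  refine ⟨2, ![1, -1], ![ofChoi P, ofChoi N], ?_, ⟨?_, ?_⟩, ?_⟩
  · simp [Fin.forall_fin_two]
  · rw [Fin.forall_fin_two]
    exact ⟨⟨ofChoi_isCompletelyPositive hP, fun X hX => (htn X hX).1⟩,
      ⟨ofChoi_isCompletelyPositive hN, fun X hX => (htn X hX).2⟩⟩
  · rw [Fin.sum_univ_two]
    refine ⟨?_, htp⟩
    change IsCompletelyPositive (ofChoi P + ofChoi N)
    rw [← ofChoi_add]
    exact ofChoi_isCompletelyPositive (hP.add hN)
  · rw [Fin.sum_univ_two, sub_eq_add_neg]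
    exact congrArg₂ (· + ·) (one_smul ℂ _).symm (neg_one_smul ℂ _).symm

theorem sdpValues_subset_twistedCosts [DecidableEq b] [Nonempty a] [Nonempty b]
    (E : Matrix a a ℂ →ₗ[ℂ] Matrix b b ℂ) : sdpValues E ⊆ twistedCosts E := by
  intro α hα
  have hα0 := nonneg_of_mem_sdpValues hα
  obtain ⟨P, N, hPN, hP, hN, h⟩ := hα
  rcases hα0.eq_or_lt with rfl | hpos
  · have htr : P.trace + N.trace = 0 := by
      rw [← Matrix.trace_add, ← trace_partialTraceRight, h]
      simp
    have hP0 : P = 0 := hP.trace_eq_zero_iff.1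
      ((add_eq_zero_iff_of_nonneg hP.trace_nonneg hN.trace_nonneg).1 htr).1
    have hN0 : N = 0 := hN.trace_eq_zero_iff.1
      ((add_eq_zero_iff_of_nonneg hP.trace_nonneg hN.trace_nonneg).1 htr).2
    -- For `α = 0` division is impossible, but `E = 0` and any twisted channel serves; this one is
    -- the completely depolarizing channel.
    refine ⟨le_rfl, _, isTwistedChannel_ofChoi_sub
      (Matrix.PosSemidef.one.kronecker (isState_maximallyMixed b).1) Matrix.PosSemidef.zero
      (by rw [add_zero, partialTraceRight_kronecker, (isState_maximallyMixed b).2, one_smul]), ?_⟩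
    rw [← ofChoi_choi E, hPN, hP0, hN0, ofChoi_sub]
    simp
  · have hinv : (0 : ℂ) ≤ (α : ℂ)⁻¹ := by
      rw [← Complex.ofReal_inv]
      exact Complex.zero_le_real.2 (inv_nonneg.2 hα0)
    have hne : (α : ℂ) ≠ 0 := Complex.ofReal_ne_zero.2 hpos.ne'
    refine ⟨hα0, _, isTwistedChannel_ofChoi_sub (hP.smul hinv) (hN.smul hinv) ?_, ?_⟩
    · rw [← smul_add, partialTraceRight_smul, h, inv_smul_smul₀ hne]
    · rw [← ofChoi_sub, ← smul_sub, ← hPN]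
      conv_lhs => rw [← ofChoi_choi E]
      refine LinearMap.ext fun X => ?_
      ext x y
      simp only [LinearMap.smul_apply, Matrix.smul_apply, ofChoi_apply, smul_eq_mul,
        Finset.mul_sum]
      refine Finset.sum_congr rfl fun i _ => Finset.sum_congr rfl fun j _ => ?_
      field_simp

theorem twistedCosts_eq_sdpValues [DecidableEq b] [Nonempty a] [Nonempty b]
    (E : Matrix a a ℂ →ₗ[ℂ] Matrix b b ℂ) : twistedCosts E = sdpValues E :=
  (twistedCosts_subset_sdpValues E).antisymm (sdpValues_subset_twistedCosts E)

end TwistedChannels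

end QuantumMap

end

/-- For a Hermitian-preserving map `E`, all the optima are attained, the simulation cost with
twisted channels is the optimal value of the semidefinite program, and it equals the diamond norm.
-/
theorem theorem2 {a b : Type*} [Fintype a] [DecidableEq a] [Nonempty a]
    [Fintype b] [DecidableEq b] [Nonempty b]
    (E : Matrix a a ℂ →ₗ[ℂ] Matrix b b ℂ) (hE : QuantumMap.IsHermitianPreserving E) :
    IsLeast (QuantumMap.twistedCosts E) (QuantumMap.simulationCost E) ∧
    IsLeast (QuantumMap.sdpValues E) (QuantumMap.simulationCost E) ∧
    IsGreatest (QuantumMap.diamondValues E) (QuantumMap.diamondNorm E) ∧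
    QuantumMap.simulationCost E = QuantumMap.diamondNorm E := by
  have hleast := QuantumMap.isLeast_sdpValues_diamondNorm hE
  have heq : QuantumMap.simulationCost E = QuantumMap.diamondNorm E := by
    rw [QuantumMap.simulationCost, QuantumMap.twistedCosts_eq_sdpValues, hleast.csInf_eq]
  rw [QuantumMap.twistedCosts_eq_sdpValues, heq]
  exact ⟨hleast, hleast, QuantumMap.isGreatest_diamondValues hE, rfl⟩
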